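/- Let $p\in(1,2]$, $q=p/(p-1)$, $n\in\mathbb N$, and identify $\mathbb R^n$ with its dual through $\langle u,x\rangle=u^\top x$. Let $f\colon\mathbb R^n\to\mathbb R$ be convex and $L$-smooth with respect to $\|\cdot\|_p$, i.e. $L>0$, $f$ is differentiable, and $\|\nabla f(x)-\nabla f(y)\|_{*}\le L\|x-y\|_p$ for all $x,y$, where $\|u\|_*=\sup_{\|x\|_p\le 1}\langle u,x\rangle$ is the dual norm of $\|\cdot\|_p$. Let $x_\star$ be a minimizer of $f$, let $x_0\in\mathbb R^n$, let $N\ge 1$, and put $\sigma=\tau=p-1$, $$\phi(x)=\tfrac12\|x-x_0\|_p^2,\qquad \psi(x)=\tfrac12\|x\|_p^2,\qquad y_0=\nabla\phi(x_0).$$ Let $\theta_i=0$ for $i<0$, and let $\theta_0,\dots,\theta_N>0$ satisfy $\theta_i^2-\theta_i=\theta_{i-1}^2$ for $i=0,\dots,N-1$ and $\theta_N=\theta_{N-1}$. Write $h^*(u)=\sup_x\{\langle u,x\rangle-h(x)\}$ for the convex conjugate. Accelerated mirror descent (AMD) starts from $y_0$ and $\nabla\phi^*(y_0)$ (which is the given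 point $x_0$, see below) and computes, for $k=0,\dots,N-1$, $$y_{k+1}=y_k-\tfrac{\sigma}{L}(\theta_k^2-\theta_{k-1}^2)\nabla f(x_k),$$ $$x_{k+1}=\tfrac{\theta_k^2}{\theta_{k+1}^2}x_k+\tfrac{\theta_{k+1}^2-\theta_k^2}{\theta_{k+1}^2}\nabla\phi^*(y_{k+1})+\tfrac{\theta_k^2-\theta_{k-1}^2}{\theta_{k+1}^2}\bigl(\nabla\phi^*(y_{k+1})-\nabla\phi^*(y_k)\bigr).$$ Dual-AMD then starts from $q_0=x_N$, $g_0=\theta_N^{-2}\nabla f(q_0)$, $r_0=\tfrac{\theta_N^2-\theta_{N-2}^2}{\theta_N^2}\nabla f(q_0)$ and computes, for $k=0,\dots,N-1$, $$q_{k+1}=q_k-\tfrac{\tau}{L}(\theta_{N-k-1}^2-\theta_{N-k-2}^2)\nabla\psi^*(r_k),\qquad g_{k+1}=g_k+\tfrac1{\theta_{N-k-1}^2}\bigl(\nabla f(q_{k+1})-\nabla f(q_k)\bigr),$$ $$r_{k+1}=r_k+(\theta_{N-k-1}^2-\theta_{N-k-2}^2)(g_{k+1}-g_k)+(\theta_{N-k-2}^2-\theta_{N-k-3}^2)g_{k+1}.$$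 The output of the concatenation is $x_{2N}:=q_N$. Then $\phi^*$ and $\psi^*$ are finite and differentiable on $\mathbb R^n$ (so that the iterates are well defined), $y_0=0$, $\nabla\phi^*(y_0)=x_0$, and $$\|\nabla f(x_{2N})\|_q\;\le\;\frac{L\|x_0-x_\star\|_p}{(p-1)\theta_N^2}\;=\;\mathcal O\!\left(\frac{L\|x_0-x_\star\|_p}{N^2}\right),$$ where the constant in $\mathcal O(\cdot)$ depends on $p$ only; more precisely there is an absolute constant $C>0$ (independent of $p,n,f,L,x_0,x_\star,N$) such that the middle term is at most $\frac{C}{p-1}\cdot\frac{L\|x_0-x_\star\|_p}{N^2}$. -/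

import Mathlib

open scoped BigOperators

noncomputable section

namespace MirrorDuality

/-- The space `ℝⁿ`. It is its own dual through the pairing `⟨u, x⟩ = uᵀ x = u ⬝ᵥ x`. -/
abbrev Vec (n : ℕ) : Type := Fin n → ℝ

/-- The norm `‖x‖_p` on `ℝⁿ`, for a real exponent `p`. -/
def lpNorm {n : ℕ} (p : ℝ) (x : Vec n) : ℝ :=
  ‖(WithLp.toLp (ENNReal.ofReal p) x : PiLp (ENNReal.ofReal p) (fun _ : Fin n => ℝ))‖

theorem lpNorm_eq {n : ℕ} {p : ℝ} (hp : 0 < p) (x : Vec n) :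
    lpNorm p x = (∑ i, |x i| ^ p) ^ (1 / p) := by
  have h : 0 < (ENNReal.ofReal p).toReal := by rwa [ENNReal.toReal_ofReal hp.le]
  simp [lpNorm, PiLp.norm_eq_sum h, ENNReal.toReal_ofReal hp.le]

/-- The dual norm `‖u‖_* = sup {⟨u, x⟩ : ‖x‖_p ≤ 1}` of `‖·‖_p`. -/
def dualLpNorm {n : ℕ} (p : ℝ) (u : Vec n) : ℝ :=
  sSup {t : ℝ | ∃ x : Vec n, lpNorm p x ≤ 1 ∧ t = u ⬝ᵥ x}

/-- The gradient of `f` at `x`: the vector of partial derivatives, which represents the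
Fréchet derivative with respect to the pairing `⟨u, h⟩ = uᵀ h`. -/
def grad {n : ℕ} (f : Vec n → ℝ) (x : Vec n) : Vec n :=
  fun i => fderiv ℝ f x (Pi.single i 1)

theorem grad_dotProduct {n : ℕ} (f : Vec n → ℝ) (x h : Vec n) :
    grad f x ⬝ᵥ h = fderiv ℝ f x h := by
  conv_rhs => rw [pi_eq_sum_univ' h]
  simp [grad, dotProduct, map_sum, mul_comm, Pi.single]

/-- `f : ℝⁿ → ℝ` is `L`-smooth with respect to `‖·‖_p`. -/
structure IsLSmooth {n : ℕ} (p L : ℝ) (f : Vec n → ℝ) : Prop where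
  pos : 0 < L
  differentiable : Differentiable ℝ f
  lipschitz : ∀ x y, dualLpNorm p (grad f x - grad f y) ≤ L * lpNorm p (x - y)

/-- The supremum defining `h*(u)` is finite for every `u`. -/
def ConjFinite {n : ℕ} (h : Vec n → ℝ) : Prop :=
  ∀ u : Vec n, BddAbove (Set.range fun x : Vec n => u ⬝ᵥ x - h x)

/-- The convex conjugate `h*(u) = sup_x (⟨u, x⟩ - h x)`
(the true supremum whenever `ConjFinite h` holds). -/
def conj {n : ℕ} (h : Vec n → ℝ) (u : Vec n) : ℝ :=
  ⨆ x : Vec n, (u ⬝ᵥ x - h x)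

/-- The parameters `θ_{-2}, θ_{-1}, θ_0, …, θ_N` of the two methods: `θ_i = 0` for `i < 0`,
`θ_0, …, θ_N > 0`, `θ_i² - θ_i = θ_{i-1}²` for `i = 0, …, N - 1`, and `θ_N = θ_{N-1}`. -/
structure IsThetaSeq (N : ℕ) (θ : ℤ → ℝ) : Prop where
  neg : ∀ i : ℤ, i < 0 → θ i = 0
  pos : ∀ i : ℤ, 0 ≤ i → i ≤ N → 0 < θ i
  recurrence : ∀ i : ℤ, 0 ≤ i → i ≤ (N : ℤ) - 1 → θ i ^ 2 - θ i = θ (i - 1) ^ 2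
  last : θ N = θ ((N : ℤ) - 1)

/-- The state `(y_k, x_k)` of accelerated mirror descent. -/
structure AMDState (n : ℕ) where
  y : Vec n
  x : Vec n

/-- Accelerated mirror descent (AMD) for the objective `f` and the distance-generating
function `φ`, started from `y_0` and `x_0 = ∇φ*(y_0)`. -/
def amd {n : ℕ} (f φ : Vec n → ℝ) (L σ : ℝ) (θ : ℤ → ℝ) (y₀ : Vec n) : ℕ → AMDState n
  | 0 => ⟨y₀, grad (conj φ) y₀⟩
  | k + 1 =>
    let s := amd f φ L σ θ y₀ k
    let y' := s.y - (σ / L * (θ k ^ 2 - θ ((k : ℤ) - 1) ^ 2)) • grad f s.x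
    let x' := (θ k ^ 2 / θ ((k : ℤ) + 1) ^ 2) • s.x
      + ((θ ((k : ℤ) + 1) ^ 2 - θ k ^ 2) / θ ((k : ℤ) + 1) ^ 2) • grad (conj φ) y'
      + ((θ k ^ 2 - θ ((k : ℤ) - 1) ^ 2) / θ ((k : ℤ) + 1) ^ 2) •
          (grad (conj φ) y' - grad (conj φ) s.y)
    ⟨y', x'⟩

/-- The state `(q_k, g_k, r_k)` of dual accelerated mirror descent. -/
structure DualAMDState (n : ℕ) where
  q : Vec n
  g : Vec n
  r : Vec n

/-- Dual accelerated mirror descent (dual-AMD) with horizon `N` for the objective `f` and the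
distance-generating function `ψ`, started from `q_0`, `g_0 = θ_N⁻² ∇f(q_0)` and
`r_0 = ((θ_N² - θ_{N-2}²) / θ_N²) ∇f(q_0)`. -/
def dualAMD {n : ℕ} (f ψ : Vec n → ℝ) (L τ : ℝ) (θ : ℤ → ℝ) (N : ℕ) (q₀ : Vec n) :
    ℕ → DualAMDState n
  | 0 => ⟨q₀, (1 / θ N ^ 2) • grad f q₀,
      ((θ N ^ 2 - θ ((N : ℤ) - 2) ^ 2) / θ N ^ 2) • grad f q₀⟩
  | k + 1 =>
    let s := dualAMD f ψ L τ θ N q₀ k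
    let q' := s.q - (τ / L * (θ ((N : ℤ) - k - 1) ^ 2 - θ ((N : ℤ) - k - 2) ^ 2)) •
      grad (conj ψ) s.r
    let g' := s.g + (1 / θ ((N : ℤ) - k - 1) ^ 2) • (grad f q' - grad f s.q)
    let r' := s.r
      + (θ ((N : ℤ) - k - 1) ^ 2 - θ ((N : ℤ) - k - 2) ^ 2) • (g' - s.g)
      + (θ ((N : ℤ) - k - 2) ^ 2 - θ ((N : ℤ) - k - 3) ^ 2) • g'
    ⟨q', g', r'⟩

/-- The output `x_{2N}` of the concatenation: `N` steps of AMD from `y_0` give `x_N`, and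
`N` steps of dual-AMD from `q_0 = x_N` give `x_{2N} = q_N`. -/
def concatOutput {n : ℕ} (f φ ψ : Vec n → ℝ) (L σ τ : ℝ) (θ : ℤ → ℝ) (N : ℕ)
    (y₀ : Vec n) : Vec n :=
  (dualAMD f ψ L τ θ N (amd f φ L σ θ y₀ N).x N).q

/-- The distance-generating function `½‖· - c‖_p²`. -/
def halfSqNorm {n : ℕ} (p : ℝ) (c : Vec n) (x : Vec n) : ℝ :=
  1 / 2 * lpNorm p (x - c) ^ 2

end MirrorDuality

end

/-! Both methods lose one factor $L/((p-1)\theta_N^2)$, and the two losses multiply. With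
$D=\|x_0-x_\star\|_p$, AMD gives $f(x_N)-f(x_\star)\le\frac{L}{(p-1)\theta_N^2}\cdot\frac12D^2$
(`amd_rate`). Dual-AMD gives $\psi^*(r_N)\le\frac{L}{(p-1)\theta_N^2}(f(x_N)-f(x_{2N}))$
(`dualAMD_conj_le`), where $r_N=\nabla f(x_{2N})$ (`dualAMD_r_last`). Since
$\psi^*\ge\frac12\|\cdot\|_q^2$ and $f(x_{2N})\ge f(x_\star)$, chaining the bounds and taking a
square root gives the rate.

Each energy estimate adds a cocoercivity inequality for $f$ to a Bregman inequality for the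
conjugate. The free direction in `IsLSmooth.cocoercive` is taken along the change of the mirror
point, so that the two squared norms cancel.

The Bregman inequality is $(p-1)$-strong convexity of $\frac12\|\cdot\|_p^2$. It comes from the
two-point inequality, applied in each coordinate and summed by reverse Minkowski in $\ell^{p/2}$.
Strong convexity enters only as `HasGrowth`, which also yields differentiability of the conjugates.
-/

namespace MirrorDuality

/-! ### Two-point inequality on the real line -/

/-- Bernoulli's inequality for a nonpositive exponent. -/
theorem one_add_mul_le_rpow_of_nonpos {x m : ℝ} (hx : 0 < x) (hm : m ≤ 0) :
    1 + m * (x - 1) ≤ x ^ m := by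
  rw [Real.rpow_def_of_pos hx]
  have h1 := Real.add_one_le_exp (Real.log x * m)
  have h2 := Real.log_le_sub_one_of_pos hx
  nlinarith

/-- The difference of the two sides has derivative $s((1+x)^{s-1}+(1-x)^{s-1}-2)$. Tangent lines at
1 bound both powers from below, and their linear terms cancel. -/
theorem two_mul_le_rpow_sub_rpow {s t : ℝ} (hs : 0 < s) (hs1 : s ≤ 1) (ht : 0 ≤ t)
    (ht1 : t ≤ 1) : 2 * s * t ≤ (1 + t) ^ s - (1 - t) ^ s := by
  have hd : ∀ x ∈ interior (Set.Icc (0 : ℝ) 1),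
      HasDerivAt (fun t : ℝ => (1 + t) ^ s - (1 - t) ^ s - 2 * s * t)
        (1 * s * (1 + x) ^ (s - 1) - (-1) * s * (1 - x) ^ (s - 1) - 2 * s * 1) x := by
    intro x hx
    rw [interior_Icc] at hx
    exact ((((hasDerivAt_id x).const_add 1).rpow_const (Or.inl (by simp; linarith [hx.1]))).sub
      (((hasDerivAt_id x).const_sub 1).rpow_const (Or.inl (by simp; linarith [hx.2])))).sub
      ((hasDerivAt_id x).const_mul (2 * s))
  have hmono : MonotoneOn (fun t : ℝ => (1 + t) ^ s - (1 - t) ^ s - 2 * s * t)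
      (Set.Icc 0 1) := by
    apply monotoneOn_of_deriv_nonneg (convex_Icc 0 1)
    · have h : Continuous fun x : ℝ => x ^ s := Real.continuous_rpow_const hs.le
      exact (((h.comp (continuous_const.add continuous_id)).sub
        (h.comp (continuous_const.sub continuous_id))).sub
        (continuous_const.mul continuous_id)).continuousOn
    · exact fun x hx => (hd x hx).differentiableAt.differentiableWithinAt
    · intro x hx
      rw [(hd x hx).deriv]
      rw [interior_Icc] at hx
      have h1 := one_add_mul_le_rpow_of_nonpos (x := 1 + x) (m := s - 1) (by linarith [hx.1])
        (by linarith)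
      have h2 := one_add_mul_le_rpow_of_nonpos (x := 1 - x) (m := s - 1) (by linarith [hx.2])
        (by linarith)
      nlinarith
  have := hmono (Set.left_mem_Icc.2 zero_le_one) ⟨ht, ht1⟩ ht
  simp at this
  linarith

theorem two_add_sq_le_rpow_add_rpow {p t : ℝ} (hp : 1 < p) (hp2 : p ≤ 2) (ht : 0 ≤ t)
    (ht1 : t ≤ 1) : 2 + p * (p - 1) * t ^ 2 ≤ (1 + t) ^ p + (1 - t) ^ p := by
  have hd : ∀ x : ℝ,
      HasDerivAt (fun t : ℝ => (1 + t) ^ p + (1 - t) ^ p - p * (p - 1) * t ^ 2)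
        (1 * p * (1 + x) ^ (p - 1) + (-1) * p * (1 - x) ^ (p - 1)
          - p * (p - 1) * (((2 : ℕ) : ℝ) * x ^ (2 - 1))) x := by
    intro x
    exact ((((hasDerivAt_id x).const_add 1).rpow_const (Or.inr hp.le)).add
      (((hasDerivAt_id x).const_sub 1).rpow_const (Or.inr hp.le))).sub
      ((hasDerivAt_pow 2 x).const_mul (p * (p - 1)))
  have hmono : MonotoneOn (fun t : ℝ => (1 + t) ^ p + (1 - t) ^ p - p * (p - 1) * t ^ 2)
      (Set.Icc 0 1) := by
    apply monotoneOn_of_deriv_nonneg (convex_Icc 0 1)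
    · exact fun x _ => (hd x).continuousAt.continuousWithinAt
    · exact fun x _ => (hd x).differentiableAt.differentiableWithinAt
    · intro x hx
      rw [(hd x).deriv]
      rw [interior_Icc] at hx
      have h1 := two_mul_le_rpow_sub_rpow (s := p - 1) (t := x) (by linarith) (by linarith)
        hx.1.le hx.2.le
      norm_num
      nlinarith
  have := hmono (Set.left_mem_Icc.2 zero_le_one) ⟨ht, ht1⟩ ht
  norm_num at this
  linarith

/-- By homogeneity $A=1$ and $B=t\le1$. Since $p/2\le1$, Bernoulli bounds the left side by $1+\frac
p2(p-1)t^2$, which `two_add_sq_le_rpow_add_rpow` controls. -/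
theorem sq_add_sq_rpow_le_of_le {p A B : ℝ} (hp : 1 < p) (hp2 : p ≤ 2) (hB : 0 ≤ B)
    (hBA : B ≤ A) :
    (A ^ 2 + (p - 1) * B ^ 2) ^ (p / 2) ≤ ((A + B) ^ p + (A - B) ^ p) / 2 := by
  rcases (hB.trans hBA).eq_or_lt with h | hA
  · have hB0 : B = 0 := by linarith
    have hp0 : p ≠ 0 := by linarith
    simp [← h, hB0, hp0]
  · obtain ⟨t, rfl⟩ : ∃ t, B = A * t := ⟨B / A, by field_simp⟩
    have ht : 0 ≤ t := nonneg_of_mul_nonneg_right hB hA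
    have ht1 : t ≤ 1 := by nlinarith
    have hA2 : (A ^ 2) ^ (p / 2) = A ^ p := by
      rw [← Real.rpow_natCast, ← Real.rpow_mul hA.le]
      congr 1
      push_cast
      ring
    have hq : 0 ≤ (p - 1) * t ^ 2 := mul_nonneg (by linarith) (sq_nonneg t)
    rw [show A ^ 2 + (p - 1) * (A * t) ^ 2 = A ^ 2 * (1 + (p - 1) * t ^ 2) by ring,
      show A + A * t = A * (1 + t) by ring, show A - A * t = A * (1 - t) by ring,
      Real.mul_rpow (sq_nonneg A) (by linarith), Real.mul_rpow hA.le (by linarith),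
      Real.mul_rpow hA.le (by linarith), hA2, ← mul_add, mul_div_assoc]
    refine mul_le_mul_of_nonneg_left ?_ (Real.rpow_nonneg hA.le p)
    have h1 := rpow_one_add_le_one_add_mul_self (s := (p - 1) * t ^ 2) (by linarith)
      (p := p / 2) (by linarith) (by linarith)
    have h2 := two_add_sq_le_rpow_add_rpow hp hp2 ht ht1
    linarith

/-- Gross' two-point inequality. -/
theorem sq_add_sq_rpow_le {p : ℝ} (hp : 1 < p) (hp2 : p ≤ 2) (a b : ℝ) :
    (a ^ 2 + (p - 1) * b ^ 2) ^ (p / 2) ≤ (|a + b| ^ p + |a - b| ^ p) / 2 := by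
  -- The right side is symmetric in $a,b$. As $p-1\le1$, the left side is larger when the bigger
  -- square has coefficient 1.
  wlog h : |b| ≤ |a| generalizing a b
  · have h' := this b a (not_le.1 h).le
    rw [abs_sub_comm, add_comm b a] at h'
    refine le_trans ?_ h'
    have : a ^ 2 ≤ b ^ 2 := sq_le_sq.2 (not_le.1 h).le
    apply Real.rpow_le_rpow
    · nlinarith [sq_nonneg a, sq_nonneg b]
    · nlinarith
    · linarith
  have key := sq_add_sq_rpow_le_of_le hp hp2 (abs_nonneg b) h
  rw [sq_abs, sq_abs] at key
  refine key.trans (le_of_eq ?_)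
  rcases abs_cases a with ⟨ha, ha'⟩ | ⟨ha, ha'⟩ <;> rcases abs_cases b with ⟨hb, hb'⟩ | ⟨hb, hb'⟩ <;>
    rw [ha, hb] at h ⊢
  · rw [abs_of_nonneg (by linarith : 0 ≤ a + b), abs_of_nonneg (by linarith : 0 ≤ a - b)]
  · rw [abs_of_nonneg (by linarith : 0 ≤ a + b), abs_of_nonneg (by linarith : 0 ≤ a - b)]
    rw [show a - -b = a + b by ring, show a + -b = a - b by ring, add_comm]
  · rw [abs_of_nonpos (by linarith : a + b ≤ 0), abs_of_nonpos (by linarith : a - b ≤ 0)]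
    rw [show -(a - b) = -a + b by ring, show -(a + b) = -a - b by ring, add_comm]
  · rw [abs_of_nonpos (by linarith : a + b ≤ 0), abs_of_nonpos (by linarith : a - b ≤ 0)]
    rw [show -(a - b) = -a - -b by ring, show -(a + b) = -a + -b by ring]

/-! ### Two-uniform convexity and duality of the p-norm -/

section LpNorm

variable {n : ℕ} {p : ℝ}

theorem fact_one_le_ofReal (hp : 1 ≤ p) : Fact (1 ≤ ENNReal.ofReal p) :=
  ⟨by simpa using ENNReal.ofReal_le_ofReal hp⟩

theorem lpNorm_nonneg (hp : 1 ≤ p) (x : Vec n) : 0 ≤ lpNorm p x := by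
  have := fact_one_le_ofReal hp
  exact norm_nonneg _

theorem lpNorm_smul (hp : 1 ≤ p) (c : ℝ) (x : Vec n) : lpNorm p (c • x) = |c| * lpNorm p x := by
  have := fact_one_le_ofReal hp
  rw [lpNorm, WithLp.toLp_smul, norm_smul, Real.norm_eq_abs, lpNorm]

theorem lpNorm_neg (hp : 1 ≤ p) (x : Vec n) : lpNorm p (-x) = lpNorm p x := by
  have := lpNorm_smul hp (-1) x
  simpa using this

theorem lpNorm_sub_comm (hp : 1 ≤ p) (x y : Vec n) : lpNorm p (x - y) = lpNorm p (y - x) := by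
  rw [← lpNorm_neg hp, neg_sub]

theorem lpNorm_sum_le {ι : Type*} (hp : 1 ≤ p) (s : Finset ι) (f : ι → Vec n) :
    lpNorm p (∑ i ∈ s, f i) ≤ ∑ i ∈ s, lpNorm p (f i) := by
  have := fact_one_le_ofReal hp
  simp only [lpNorm, WithLp.toLp_sum]
  exact norm_sum_le _ _

theorem norm_le_lpNorm (hp : 1 ≤ p) (x : Vec n) : ‖x‖ ≤ lpNorm p x := by
  have := fact_one_le_ofReal hp
  exact (pi_norm_le_iff_of_nonneg (lpNorm_nonneg hp x)).2 fun i =>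
    PiLp.norm_apply_le (WithLp.toLp (ENNReal.ofReal p) x) i

theorem lpNorm_zero (hp : 1 ≤ p) : lpNorm p (0 : Vec n) = 0 := by
  have := fact_one_le_ofReal hp
  simp [lpNorm]

theorem eq_zero_of_lpNorm_eq_zero (hp : 1 ≤ p) {x : Vec n} (h : lpNorm p x = 0) : x = 0 :=
  norm_le_zero_iff.1 (h ▸ norm_le_lpNorm hp x)

theorem continuous_lpNorm (hp : 1 ≤ p) : Continuous (lpNorm p : Vec n → ℝ) := by
  have := fact_one_le_ofReal hp
  exact continuous_norm.comp (PiLp.continuous_toLp _ _)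

theorem lpNorm_sq (hp : 0 < p) (x : Vec n) : lpNorm p x ^ 2 = (∑ i, |x i| ^ p) ^ (2 / p) := by
  rw [lpNorm_eq hp, ← Real.rpow_natCast, ← Real.rpow_mul]
  · congr 1
    push_cast
    ring
  · exact Finset.sum_nonneg fun i _ => Real.rpow_nonneg (abs_nonneg _) _

theorem rpow_two_div_rpow {p : ℝ} (hp : 0 < p) {x : ℝ} (hx : 0 ≤ x) :
    (x ^ p) ^ (2 / p) = x ^ 2 := by
  rw [← Real.rpow_mul hx, ← Real.rpow_natCast]
  congr 1
  field_simp
  norm_num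

/-- The reverse Minkowski inequality in `ℓ^{p/2}` for two vectors of squares. -/
theorem sq_lpNorm_add_sq_lpNorm_le (hp : 0 < p) (hp2 : p ≤ 2) {c : ℝ} (hc : 0 ≤ c) (a b : Vec n) :
    lpNorm p a ^ 2 + c * lpNorm p b ^ 2
      ≤ (∑ i, (a i ^ 2 + c * b i ^ 2) ^ (p / 2)) ^ (2 / p) := by
  have h1 : (1 : ℝ) ≤ 2 / p := by rw [le_div_iff₀ hp]; linarith
  have h0 : (0 : ℝ) < 2 / p := by positivity
  set d : ℝ := c ^ (p / 2)
  have hd : 0 ≤ d := Real.rpow_nonneg hc _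
  have hdc : d ^ (2 / p) = c := by
    rw [← Real.rpow_mul hc, show p / 2 * (2 / p) = 1 by field_simp, Real.rpow_one]
  have hs : ∀ x : Vec n, 0 ≤ ∑ i, |x i| ^ p := fun x =>
    Finset.sum_nonneg fun i _ => Real.rpow_nonneg (abs_nonneg _) _
  -- This is the triangle inequality in $\ell^{2/p}$ on the plane, with $2/p\ge1$; the weight
  -- satisfies $d^{2/p}=c$.
  have h := lpNorm_sum_le h1 Finset.univ fun i => (![|a i| ^ p, d * |b i| ^ p] : Vec 2)
  have hsum : ∑ i, (![|a i| ^ p, d * |b i| ^ p] : Vec 2)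
      = ![∑ i, |a i| ^ p, d * ∑ i, |b i| ^ p] := by
    ext j
    fin_cases j <;> simp [Finset.sum_apply, Finset.mul_sum]
  have hterm : ∀ i, lpNorm (2 / p) (![|a i| ^ p, d * |b i| ^ p] : Vec 2)
      = (a i ^ 2 + c * b i ^ 2) ^ (p / 2) := by
    intro i
    have ha := Real.rpow_nonneg (abs_nonneg (a i)) p
    have hb := Real.rpow_nonneg (abs_nonneg (b i)) p
    rw [lpNorm_eq h0, Fin.sum_univ_two]
    simp only [Matrix.cons_val_zero, Matrix.cons_val_one]
    rw [abs_of_nonneg ha, abs_of_nonneg (mul_nonneg hd hb), Real.mul_rpow hd hb, hdc,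
      rpow_two_div_rpow hp (abs_nonneg _), rpow_two_div_rpow hp (abs_nonneg _), sq_abs, sq_abs,
      one_div_div]
  simp only [hterm] at h
  rw [hsum, lpNorm_eq h0, Fin.sum_univ_two] at h
  simp only [Matrix.cons_val_zero, Matrix.cons_val_one] at h
  rw [abs_of_nonneg (hs a), abs_of_nonneg (mul_nonneg hd (hs b)), Real.mul_rpow hd (hs b), hdc,
    ← lpNorm_sq hp, ← lpNorm_sq hp, one_div_div] at h
  have hX : 0 ≤ lpNorm p a ^ 2 + c * lpNorm p b ^ 2 := by positivity
  calc lpNorm p a ^ 2 + c * lpNorm p b ^ 2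
      = ((lpNorm p a ^ 2 + c * lpNorm p b ^ 2) ^ (p / 2)) ^ (2 / p) := by
        rw [← Real.rpow_mul hX, show p / 2 * (2 / p) = 1 by field_simp, Real.rpow_one]
    _ ≤ _ := Real.rpow_le_rpow (Real.rpow_nonneg hX _) h h0.le

theorem rpow_add_div_two_le {r x y : ℝ} (hr : 1 ≤ r) (hx : 0 ≤ x) (hy : 0 ≤ y) :
    ((x + y) / 2) ^ r ≤ (x ^ r + y ^ r) / 2 := by
  have h := (convexOn_rpow hr).2 (Set.mem_Ici.2 hx) (Set.mem_Ici.2 hy)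
    (by norm_num : (0 : ℝ) ≤ 1 / 2) (by norm_num : (0 : ℝ) ≤ 1 / 2) (by norm_num)
  simp only [smul_eq_mul] at h
  rw [show (x + y) / 2 = 1 / 2 * x + 1 / 2 * y by ring]
  linarith

/-- The two-uniform convexity inequality of Ball, Carlen and Lieb for `‖·‖_p`, `1 < p ≤ 2`. -/
theorem sq_lpNorm_add_mul_sq_lpNorm_le (hp : 1 < p) (hp2 : p ≤ 2) (a b : Vec n) :
    lpNorm p a ^ 2 + (p - 1) * lpNorm p b ^ 2
      ≤ (lpNorm p (a + b) ^ 2 + lpNorm p (a - b) ^ 2) / 2 := by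
  have hp0 : 0 < p := by linarith
  refine (sq_lpNorm_add_sq_lpNorm_le hp0 hp2 (by linarith) a b).trans ?_
  have hs : ∀ x : Vec n, 0 ≤ ∑ i, |x i| ^ p := fun x =>
    Finset.sum_nonneg fun i _ => Real.rpow_nonneg (abs_nonneg _) _
  rw [lpNorm_sq hp0, lpNorm_sq hp0]
  refine le_trans ?_ (rpow_add_div_two_le (by rw [le_div_iff₀ hp0]; linarith) (hs _) (hs _))
  apply Real.rpow_le_rpow
  · refine Finset.sum_nonneg fun i _ => Real.rpow_nonneg ?_ _
    nlinarith [sq_nonneg (a i), sq_nonneg (b i)]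
  · rw [← Finset.sum_add_distrib, Finset.sum_div]
    exact Finset.sum_le_sum fun i _ => sq_add_sq_rpow_le hp hp2 (a i) (b i)
  · positivity

theorem abs_dotProduct_le (hp : 1 ≤ p) (u x : Vec n) :
    |u ⬝ᵥ x| ≤ n * ‖u‖ * lpNorm p x := by
  calc |u ⬝ᵥ x| ≤ ∑ i, |u i * x i| := Finset.abs_sum_le_sum_abs _ _
    _ ≤ ∑ _i : Fin n, ‖u‖ * lpNorm p x := by
        refine Finset.sum_le_sum fun i _ => ?_
        rw [abs_mul]
        exact mul_le_mul (norm_le_pi_norm u i) ((norm_le_pi_norm x i).trans (norm_le_lpNorm hp x))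
          (abs_nonneg _) (norm_nonneg _)
    _ = n * ‖u‖ * lpNorm p x := by simp [mul_assoc]

theorem dotProduct_le_dualLpNorm_mul (hp : 1 ≤ p) (u x : Vec n) :
    u ⬝ᵥ x ≤ dualLpNorm p u * lpNorm p x := by
  rcases (lpNorm_nonneg hp x).eq_or_lt with h | h
  · simp [eq_zero_of_lpNorm_eq_zero hp h.symm, lpNorm_zero hp]
  · have hb : BddAbove {t : ℝ | ∃ x : Vec n, lpNorm p x ≤ 1 ∧ t = u ⬝ᵥ x} := by
      refine ⟨n * ‖u‖, ?_⟩
      rintro t ⟨y, hy, rfl⟩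
      refine (le_abs_self _).trans ((abs_dotProduct_le hp u y).trans ?_)
      exact mul_le_of_le_one_right (by positivity) hy
    have := le_csSup hb ⟨(lpNorm p x)⁻¹ • x, by
      rw [lpNorm_smul hp, abs_of_pos (by positivity), inv_mul_cancel₀ h.ne'], rfl⟩
    rw [dotProduct_smul, smul_eq_mul, inv_mul_eq_div, div_le_iff₀ h] at this
    exact this

/-- A vector at which Hölder's inequality is an equality. -/
theorem exists_dotProduct_eq_lpNorm {q : ℝ} (hpq : p.HolderConjugate q) (u : Vec n) :
    ∃ x : Vec n, lpNorm p x ≤ 1 ∧ u ⬝ᵥ x = lpNorm q u := by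
  obtain ⟨⟨g, hg, hgu⟩, -⟩ :=
    NNReal.isGreatest_Lp Finset.univ (fun i => ‖u i‖₊) hpq.symm
  -- The weights $g$ are extremal for $|u|$; the signs of $u$ make the pairing with $u$ itself
  -- extremal.
  refine ⟨fun i => SignType.sign (u i) * g i, ?_, ?_⟩
  · rw [lpNorm_eq hpq.pos]
    apply Real.rpow_le_one
    · exact Finset.sum_nonneg fun i _ => Real.rpow_nonneg (abs_nonneg _) _
    · have hg' : ∑ i, (g i : ℝ) ^ p ≤ 1 := by exact_mod_cast hg
      refine le_trans (Finset.sum_le_sum fun i _ => ?_) hg'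
      apply Real.rpow_le_rpow (abs_nonneg _) _ hpq.nonneg
      rw [abs_mul, NNReal.abs_eq]
      apply mul_le_of_le_one_left (g i).2
      rcases lt_trichotomy (u i) 0 with h | h | h <;> simp [h]
    · exact (one_div_pos.2 hpq.pos).le
  · rw [lpNorm_eq hpq.symm.pos]
    have := congrArg ((↑) : NNReal → ℝ) hgu
    push_cast at this
    simp only [Real.norm_eq_abs] at this
    rw [← this, dotProduct]
    refine Finset.sum_congr rfl fun i _ => ?_
    rw [← mul_assoc, mul_comm (u i), sign_mul_self]

end LpNorm

/-! ### Conjugates of functions with quadratic growth -/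

section Conjugate

variable {n : ℕ} {p σ : ℝ}

/-- `u` is a subgradient of `h` at `z` with quadratic growth of modulus `σ` along `‖·‖_p`. -/
def HasGrowth (p σ : ℝ) (h : Vec n → ℝ) (u z : Vec n) : Prop :=
  ∀ x, h z + u ⬝ᵥ (x - z) + σ / 2 * lpNorm p (x - z) ^ 2 ≤ h x

theorem HasGrowth.fenchel_le {h : Vec n → ℝ} {u z : Vec n} (hσ : 0 ≤ σ)
    (H : HasGrowth p σ h u z) (x : Vec n) : u ⬝ᵥ x - h x ≤ u ⬝ᵥ z - h z := by
  have h1 := H x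
  rw [dotProduct_sub] at h1
  have : 0 ≤ σ / 2 * lpNorm p (x - z) ^ 2 := by positivity
  linarith

theorem HasGrowth.bddAbove {h : Vec n → ℝ} {u z : Vec n} (hσ : 0 ≤ σ)
    (H : HasGrowth p σ h u z) : BddAbove (Set.range fun x : Vec n => u ⬝ᵥ x - h x) :=
  ⟨u ⬝ᵥ z - h z, by rintro _ ⟨x, rfl⟩; exact H.fenchel_le hσ x⟩

theorem HasGrowth.conj_eq {h : Vec n → ℝ} {u z : Vec n} (hσ : 0 ≤ σ)
    (H : HasGrowth p σ h u z) : conj h u = u ⬝ᵥ z - h z :=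
  le_antisymm (ciSup_le (H.fenchel_le hσ)) (le_ciSup (H.bddAbove hσ) z)

/-- Growth at $z$ is tested at $w$, and the cross term is absorbed by completing the square. The
factor $n^2$ comes from the crude Hölder bound in the sup norm; it is harmless, as only
differentiability depends on it. -/
theorem HasGrowth.conj_add_le {h : Vec n → ℝ} {u v z w : Vec n} (hσ : 0 < σ) (hp : 1 ≤ p)
    (Hu : HasGrowth p σ h u z) (Hv : HasGrowth p σ h v w) :
    conj h v ≤ conj h u + z ⬝ᵥ (v - u) + n ^ 2 / (2 * σ) * ‖v - u‖ ^ 2 := by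
  rw [Hu.conj_eq hσ.le, Hv.conj_eq hσ.le]
  have h1 := Hu w
  have h2 := (le_abs_self _).trans (abs_dotProduct_le hp (v - u) (w - z))
  set s := lpNorm p (w - z)
  have h3 : n * ‖v - u‖ * s ≤ σ / 2 * s ^ 2 + n ^ 2 / (2 * σ) * ‖v - u‖ ^ 2 := by
    have h4 : σ / 2 * s ^ 2 + n ^ 2 / (2 * σ) * ‖v - u‖ ^ 2 - n * ‖v - u‖ * s
        = (σ * s - n * ‖v - u‖) ^ 2 / (2 * σ) := by
      field_simp
      ring
    have h5 : 0 ≤ (σ * s - n * ‖v - u‖) ^ 2 / (2 * σ) := by positivity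
    linarith
  simp only [dotProduct_sub, sub_dotProduct] at h1 h2 ⊢
  rw [dotProduct_comm z v, dotProduct_comm z u]
  linarith

/-- The first-order remainder lies between 0, by testing the supremum at $z$, and $O(\|d\|^2)$, by
`HasGrowth.conj_add_le`. -/
theorem HasGrowth.hasFDerivAt_conj {h : Vec n → ℝ} (hσ : 0 < σ) (hp : 1 ≤ p)
    (H : ∀ v, ∃ w, HasGrowth p σ h v w) {u z : Vec n} (Hu : HasGrowth p σ h u z) :
    HasFDerivAt (conj h) (dotProductBilin ℝ ℝ z).toContinuousLinearMap u := by
  rw [hasFDerivAt_iff_isLittleO_nhds_zero]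
  refine Asymptotics.IsBigO.trans_isLittleO (g := fun d : Vec n => ‖d‖ ^ 2) ?_
    (Asymptotics.isLittleO_norm_pow_id one_lt_two)
  refine Asymptotics.IsBigO.of_bound (n ^ 2 / (2 * σ)) (Filter.Eventually.of_forall fun d => ?_)
  obtain ⟨w, Hw⟩ := H (u + d)
  have h1 := Hu.conj_add_le hσ hp Hw
  have h2 := Hw.fenchel_le hσ.le z
  rw [← Hw.conj_eq hσ.le] at h2
  have h3 := Hu.conj_eq hσ.le
  have h4 : (dotProductBilin ℝ ℝ z).toContinuousLinearMap d = z ⬝ᵥ d := rfl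
  rw [add_sub_cancel_left] at h1
  rw [add_dotProduct, dotProduct_comm d z] at h2
  have h5 : 0 ≤ n ^ 2 / (2 * σ) * ‖d‖ ^ 2 := by positivity
  rw [h4, Real.norm_eq_abs, abs_of_nonneg (by linarith), norm_pow, norm_norm]
  linarith

theorem HasGrowth.grad_conj {h : Vec n → ℝ} (hσ : 0 < σ) (hp : 1 ≤ p)
    (H : ∀ v, ∃ w, HasGrowth p σ h v w) {u z : Vec n} (Hu : HasGrowth p σ h u z) :
    grad (conj h) u = z := by
  ext i
  rw [grad, (Hu.hasFDerivAt_conj hσ hp H).fderiv]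
  exact (dotProduct_single_one z i)

/-- Every linear perturbation of `h` is minimised, with quadratic growth, at `∇h*(u)`. -/
theorem hasGrowth_grad_conj {h : Vec n → ℝ} (hσ : 0 < σ) (hp : 1 ≤ p)
    (H : ∀ v, ∃ w, HasGrowth p σ h v w) (u : Vec n) : HasGrowth p σ h u (grad (conj h) u) := by
  obtain ⟨z, hz⟩ := H u
  rwa [hz.grad_conj hσ hp H]

/-- Strong convexity of `h`, expressed through the Bregman divergence of `h*`. -/
theorem HasGrowth.bregman_conj_ge {h : Vec n → ℝ} {u v z w : Vec n} (hσ : 0 ≤ σ)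
    (Hu : HasGrowth p σ h u z) (Hv : HasGrowth p σ h v w) :
    conj h v + w ⬝ᵥ (u - v) + σ / 2 * lpNorm p (w - z) ^ 2 ≤ conj h u := by
  rw [Hu.conj_eq hσ, Hv.conj_eq hσ]
  have h1 := Hu w
  rw [dotProduct_sub] at h1 ⊢
  rw [dotProduct_comm w u, dotProduct_comm w v]
  linarith

end Conjugate

/-! ### Strong convexity of the half squared norm -/

section HalfSqNorm

variable {n : ℕ} {p : ℝ}

theorem continuous_halfSqNorm (hp : 1 ≤ p) (c : Vec n) : Continuous (halfSqNorm p c) :=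
  continuous_const.mul (((continuous_lpNorm hp).comp (continuous_id.sub continuous_const)).pow 2)

theorem halfSqNorm_nonneg (c x : Vec n) : 0 ≤ halfSqNorm p c x := by
  unfold halfSqNorm
  positivity

theorem halfSqNorm_self (hp : 1 ≤ p) (c : Vec n) : halfSqNorm p c c = 0 := by
  simp [halfSqNorm, lpNorm_zero hp]

/-- Midpoint strong convexity of `½‖· - c‖_p²`. -/
theorem halfSqNorm_midpoint_le (hp : 1 < p) (hp2 : p ≤ 2) (c x z : Vec n) :
    halfSqNorm p c ((1 / 2 : ℝ) • (x + z)) + (p - 1) / 8 * lpNorm p (x - z) ^ 2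
      ≤ (halfSqNorm p c x + halfSqNorm p c z) / 2 := by
  have h := sq_lpNorm_add_mul_sq_lpNorm_le hp hp2 ((1 / 2 : ℝ) • (x + z) - c)
    ((1 / 2 : ℝ) • (x - z))
  rw [show (1 / 2 : ℝ) • (x + z) - c + (1 / 2 : ℝ) • (x - z) = x - c by module,
    show (1 / 2 : ℝ) • (x + z) - c - (1 / 2 : ℝ) • (x - z) = z - c by module,
    lpNorm_smul hp.le (1 / 2) (x - z), mul_pow, sq_abs] at h
  unfold halfSqNorm
  linarith

theorem exists_minimizer_halfSqNorm (hp : 1 ≤ p) (c u : Vec n) :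
    ∃ z, ∀ x, halfSqNorm p c z - u ⬝ᵥ z ≤ halfSqNorm p c x - u ⬝ᵥ x := by
  have hcont : Continuous fun x : Vec n => halfSqNorm p c x - u ⬝ᵥ x :=
    (continuous_halfSqNorm hp c).sub (continuous_const.dotProduct continuous_id)
  -- Coercivity: with $s=\|x-c\|_p$ and $M=n\|u\|$, expanding $(s-(M+1))^2\ge0$ gives
  -- $\frac12s^2-Ms\ge s-\frac12(M+1)^2$.
  have key : ∀ x : Vec n, ‖x - c‖ - ((n * ‖u‖ + 1) ^ 2 / 2 + u ⬝ᵥ c)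
      ≤ halfSqNorm p c x - u ⬝ᵥ x := by
    intro x
    have h1 := (le_abs_self _).trans (abs_dotProduct_le hp u (x - c))
    have h2 := norm_le_lpNorm hp (x - c)
    rw [dotProduct_sub] at h1
    unfold halfSqNorm
    nlinarith [sq_nonneg (lpNorm p (x - c) - (n * ‖u‖ + 1))]
  refine hcont.exists_forall_le (Filter.tendsto_atTop_mono key ?_)
  apply Filter.tendsto_atTop_add_const_right
  have : (fun x : Vec n => ‖x - c‖) = norm ∘ (Homeomorph.subRight c) := rfl
  rw [this]
  exact tendsto_norm_cocompact_atTop.comp (Homeomorph.subRight c).isClosedEmbedding.tendsto_cocompact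

theorem exists_hasGrowth_halfSqNorm (hp : 1 < p) (hp2 : p ≤ 2) (c u : Vec n) :
    ∃ z, HasGrowth p (p - 1) (halfSqNorm p c) u z := by
  obtain ⟨z, hz⟩ := exists_minimizer_halfSqNorm hp.le c u
  refine ⟨z, ?_⟩
  -- Using the current bound at the midpoint of $x$ and $z$, together with midpoint strong
  -- convexity, halves the deficit in the modulus. The limit recovers the full $p-1$.
  have hstep : ∀ k : ℕ, ∀ x, halfSqNorm p c z - u ⬝ᵥ z
      + (p - 1) / 2 * (1 - (1 / 2) ^ k) * lpNorm p (x - z) ^ 2 ≤ halfSqNorm p c x - u ⬝ᵥ x := by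
    intro k
    induction k with
    | zero => intro x; simpa using hz x
    | succ k ih =>
      intro x
      have h1 := ih ((1 / 2 : ℝ) • (x + z))
      have h2 := halfSqNorm_midpoint_le hp hp2 c x z
      rw [show (1 / 2 : ℝ) • (x + z) - z = (1 / 2 : ℝ) • (x - z) by module,
        lpNorm_smul hp.le (1 / 2) (x - z), mul_pow, sq_abs, dotProduct_smul, dotProduct_add,
        smul_eq_mul] at h1
      rw [pow_succ]
      linarith
  intro x
  have hlim : Filter.Tendsto (fun k : ℕ => halfSqNorm p c z - u ⬝ᵥ z
      + (p - 1) / 2 * (1 - (1 / 2) ^ k) * lpNorm p (x - z) ^ 2) Filter.atTop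
      (nhds (halfSqNorm p c z - u ⬝ᵥ z + (p - 1) / 2 * (1 - 0) * lpNorm p (x - z) ^ 2)) :=
    ((((tendsto_pow_atTop_nhds_zero_of_lt_one (by norm_num) (by norm_num)).const_sub 1).const_mul
      _).mul_const _).const_add _
  have := le_of_tendsto' hlim fun k => hstep k x
  rw [dotProduct_sub]
  linarith

theorem grad_halfSqNorm_self (hp : 1 ≤ p) (c : Vec n) : grad (halfSqNorm p c) c = 0 := by
  -- Minimality suffices: `fderiv` is zero at a local minimum, by default if the function is not
  -- differentiable there.
  have hmin : IsLocalMin (halfSqNorm p c) c := Filter.Eventually.of_forall fun x => by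
    rw [halfSqNorm_self hp]
    exact halfSqNorm_nonneg c x
  ext i
  simp [grad, hmin.fderiv_eq_zero]

theorem HasGrowth.eq_center (hp : 1 < p) {c z : Vec n}
    (H : HasGrowth p (p - 1) (halfSqNorm p c) 0 z) : z = c := by
  have h := H c
  rw [halfSqNorm_self hp.le, zero_dotProduct] at h
  have h1 := halfSqNorm_nonneg (p := p) c z
  have h2 : lpNorm p (c - z) ^ 2 = 0 := le_antisymm (by nlinarith) (sq_nonneg _)
  exact (sub_eq_zero.1 (eq_zero_of_lpNorm_eq_zero hp.le (pow_eq_zero_iff two_ne_zero |>.1 h2))).symm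

/-- The supremum is tested at $\|u\|_q\,x$, with $x$ extremal in Hölder's inequality. -/
theorem half_sq_lpNorm_le_conj {q : ℝ} (hpq : p.HolderConjugate q) {u : Vec n}
    (hb : BddAbove (Set.range fun x : Vec n => u ⬝ᵥ x - halfSqNorm p 0 x)) :
    1 / 2 * lpNorm q u ^ 2 ≤ conj (halfSqNorm p 0) u := by
  obtain ⟨x, hx, hux⟩ := exists_dotProduct_eq_lpNorm hpq u
  refine le_trans ?_ (le_ciSup hb (lpNorm q u • x))
  have h1 := lpNorm_nonneg hpq.lt.le x
  simp only [halfSqNorm, sub_zero, dotProduct_smul, smul_eq_mul, hux, lpNorm_smul hpq.lt.le,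
    mul_pow, sq_abs]
  nlinarith [mul_nonneg (sq_nonneg (lpNorm q u)) (by nlinarith : 0 ≤ 1 - lpNorm p x ^ 2)]

end HalfSqNorm

/-! ### Convex smooth functions -/

section Smooth

variable {n : ℕ} {p L : ℝ} {f : Vec n → ℝ}

theorem hasDerivAt_comp_line (hf : Differentiable ℝ f) (x d : Vec n) (t : ℝ) :
    HasDerivAt (fun s : ℝ => f (x + s • d)) (grad f (x + t • d) ⬝ᵥ d) t := by
  have h1 : HasDerivAt (fun s : ℝ => x + s • d) d t := by
    simpa using ((hasDerivAt_id t).smul_const d).const_add x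
  rw [grad_dotProduct]
  exact (hf (x + t • d)).hasFDerivAt.comp_hasDerivAt t h1

theorem add_grad_dotProduct_le (hc : ConvexOn ℝ Set.univ f) (hf : Differentiable ℝ f)
    (x y : Vec n) : f y + grad f y ⬝ᵥ (x - y) ≤ f x := by
  have heq : (fun s : ℝ => f (y + s • (x - y))) = f ∘ (AffineMap.lineMap y x : ℝ →ᵃ[ℝ] Vec n) := by
    ext s
    simp [AffineMap.lineMap_apply, add_comm]
  have hconv : ConvexOn ℝ Set.univ fun s : ℝ => f (y + s • (x - y)) := by
    rw [heq]
    exact hc.comp_affineMap (AffineMap.lineMap y x : ℝ →ᵃ[ℝ] Vec n)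
  have hd := hasDerivAt_comp_line hf y (x - y) 0
  have := hconv.le_slope_of_hasDerivAt (Set.mem_univ 0) (Set.mem_univ 1) zero_lt_one hd
  simp [slope_def_field] at this
  rw [dotProduct_sub]
  linarith

/-- The descent lemma. -/
theorem IsLSmooth.descent (hp : 1 ≤ p) (hf : IsLSmooth p L f) (x d : Vec n) :
    f (x + d) ≤ f x + grad f x ⬝ᵥ d + L / 2 * lpNorm p d ^ 2 := by
  have hd : ∀ t : ℝ, HasDerivAt
      (fun s : ℝ => f (x + s • d) - s * (grad f x ⬝ᵥ d) - L / 2 * lpNorm p d ^ 2 * s ^ 2)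
      (grad f (x + t • d) ⬝ᵥ d - 1 * (grad f x ⬝ᵥ d)
        - L / 2 * lpNorm p d ^ 2 * (((2 : ℕ) : ℝ) * t ^ (2 - 1))) t := fun t =>
    ((hasDerivAt_comp_line hf.differentiable x d t).sub ((hasDerivAt_id t).mul_const _)).sub
      ((hasDerivAt_pow 2 t).const_mul _)
  have hanti : AntitoneOn
      (fun s : ℝ => f (x + s • d) - s * (grad f x ⬝ᵥ d) - L / 2 * lpNorm p d ^ 2 * s ^ 2)
      (Set.Icc 0 1) := by
    apply antitoneOn_of_deriv_nonpos (convex_Icc 0 1)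
    · exact fun t _ => (hd t).continuousAt.continuousWithinAt
    · exact fun t _ => (hd t).differentiableAt.differentiableWithinAt
    · intro t ht
      rw [(hd t).deriv]
      rw [interior_Icc] at ht
      have h1 := dotProduct_le_dualLpNorm_mul hp (grad f (x + t • d) - grad f x) d
      have h2 := hf.lipschitz (x + t • d) x
      rw [add_sub_cancel_left, lpNorm_smul hp, abs_of_pos ht.1] at h2
      have h3 := mul_le_mul_of_nonneg_right h2 (lpNorm_nonneg hp d)
      rw [sub_dotProduct] at h1
      norm_num
      linarith
  have := hanti (Set.left_mem_Icc.2 zero_le_one) (Set.right_mem_Icc.2 zero_le_one) zero_le_one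
  simp at this
  linarith

/-- Cocoercivity of the gradient of a convex smooth function, in variational form. -/
theorem IsLSmooth.cocoercive (hp : 1 ≤ p) (hc : ConvexOn ℝ Set.univ f) (hf : IsLSmooth p L f)
    (x y d : Vec n) :
    f y + grad f y ⬝ᵥ (x - y) + (grad f y - grad f x) ⬝ᵥ d - L / 2 * lpNorm p d ^ 2 ≤ f x := by
  -- The supporting plane at $y$ and the quadratic upper model at $x$ are compared at the common
  -- point $x+d$.
  have h1 := add_grad_dotProduct_le hc hf.differentiable (x + d) y
  have h2 := hf.descent hp x d
  rw [add_sub_right_comm, dotProduct_add] at h1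
  rw [sub_dotProduct]
  linarith

end Smooth

/-! ### Growth of the parameters -/

namespace IsThetaSeq

variable {N : ℕ} {θ : ℤ → ℝ}

theorem sq_sub_sq (hθ : IsThetaSeq N θ) {i : ℤ} (h0 : 0 ≤ i) (h1 : i < N) :
    θ i ^ 2 - θ (i - 1) ^ 2 = θ i := by
  have := hθ.recurrence i h0 (by omega)
  linarith

theorem sq_sub_sq_nonneg (hθ : IsThetaSeq N θ) {i : ℤ} (h0 : 0 ≤ i) (h1 : i ≤ N) :
    0 ≤ θ i ^ 2 - θ (i - 1) ^ 2 := by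
  rcases h1.lt_or_eq with h | rfl
  · rw [hθ.sq_sub_sq h0 h]
    exact (hθ.pos i h0 h1).le
  · rw [hθ.last, sub_self]

/-- The recurrence reads $(\theta_{k+1}-\frac12)^2=\theta_k^2+\frac14$, so each step adds at least
$\frac12$. -/
theorem half_le (hθ : IsThetaSeq N θ) {k : ℕ} (hk : k < N) : ((k : ℝ) + 1) / 2 ≤ θ k := by
  induction k with
  | zero =>
    have h1 := hθ.recurrence 0 le_rfl (by omega)
    have h2 := hθ.pos 0 le_rfl (by omega)
    rw [hθ.neg (0 - 1) (by norm_num)] at h1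
    norm_num
    nlinarith
  | succ k ih =>
    have h1 := ih (by omega)
    have h2 := hθ.recurrence ((k + 1 : ℕ) : ℤ) (by omega) (by omega)
    have h3 := hθ.pos ((k + 1 : ℕ) : ℤ) (by omega) (by omega)
    rw [show (((k + 1 : ℕ) : ℤ) - 1) = (k : ℤ) by push_cast; ring] at h2
    have hk0 : (0 : ℝ) ≤ k := k.cast_nonneg
    have h4 : θ k + 1 / 2 ≤ θ ((k + 1 : ℕ) : ℤ) := by nlinarith
    push_cast at h4 ⊢
    linarith

theorem half_le_last (hθ : IsThetaSeq N θ) (hN : 1 ≤ N) : (N : ℝ) / 2 ≤ θ N := by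
  obtain ⟨m, rfl⟩ : ∃ m, N = m + 1 := ⟨N - 1, by omega⟩
  have h := hθ.half_le (k := m) (by omega)
  rw [hθ.last, show (((m + 1 : ℕ) : ℤ) - 1) = (m : ℤ) by push_cast; ring]
  push_cast
  exact h

end IsThetaSeq

/-! ### Energy argument for accelerated mirror descent -/

section AMD

variable {n : ℕ} {p L σ : ℝ} {f φ : Vec n → ℝ}

/-- One-step decrease of the energy of accelerated mirror descent. -/
theorem amd_energy_step (hp : 1 ≤ p) (hc : ConvexOn ℝ Set.univ f) (hf : IsLSmooth p L f)
    (hσ : 0 < σ) (hφ : ∀ u, HasGrowth p σ φ u (grad (conj φ) u)) {t t' : ℝ} (ht : 0 < t)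
    (ht' : 0 < t') (htt : 0 ≤ t' ^ 2 - t ^ 2) {x x' y y' c : Vec n}
    (hy : y' = y - (σ / L * t) • grad f x)
    (hx : x' = (t ^ 2 / t' ^ 2) • x + ((t' ^ 2 - t ^ 2) / t' ^ 2) • grad (conj φ) y'
      + (t / t' ^ 2) • (grad (conj φ) y' - grad (conj φ) y))
    {K : ℝ} (hK : t ^ 2 * (f x - f c)
      ≤ L / σ * (K - (conj φ y - y ⬝ᵥ c)) + t * (grad f x ⬝ᵥ (grad (conj φ) y - c))) :
    t' ^ 2 * (f x' - f c) ≤ L / σ * (K - (conj φ y' - y' ⬝ᵥ c))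
      + (t' ^ 2 - t ^ 2) * (grad f x' ⬝ᵥ (grad (conj φ) y' - c)) := by
  have hL := hf.pos
  set z := grad (conj φ) y
  set z' := grad (conj φ) y'
  set g := grad f x
  set g' := grad f x'
  have hx' : t' ^ 2 * (g' ⬝ᵥ x') = t ^ 2 * (g' ⬝ᵥ x) + (t' ^ 2 - t ^ 2) * (g' ⬝ᵥ z')
      + t * (g' ⬝ᵥ z' - g' ⬝ᵥ z) := by
    rw [hx]
    simp only [dotProduct_add, dotProduct_smul, dotProduct_sub, smul_eq_mul]
    field_simp
  have hyv : ∀ v, L / σ * (y ⬝ᵥ v - y' ⬝ᵥ v) = t * (g ⬝ᵥ v) := by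
    intro v
    rw [hy, sub_dotProduct, smul_dotProduct, smul_eq_mul]
    field_simp
    ring
  have F1 := mul_le_mul_of_nonneg_left (add_grad_dotProduct_le hc hf.differentiable c x') htt
  -- The direction $t^{-1}(z'-z)$ makes the loss exactly $\frac L2\|z'-z\|_p^2$, the gain in `F3`.
  -- The remaining pairings match the updates of $x$ and $y$.
  have F2 := mul_le_mul_of_nonneg_left (hf.cocoercive hp hc x x' (t⁻¹ • (z' - z))) (sq_nonneg t)
  have F3 := mul_le_mul_of_nonneg_left ((hφ y).bregman_conj_ge hσ.le (hφ y'))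
    (div_pos hL hσ).le
  have e1 : t ^ 2 * (f x' + g' ⬝ᵥ (x - x') + (g' - g) ⬝ᵥ (t⁻¹ • (z' - z))
        - L / 2 * lpNorm p (t⁻¹ • (z' - z)) ^ 2)
      = t ^ 2 * (f x' + g' ⬝ᵥ (x - x')) + t * ((g' - g) ⬝ᵥ (z' - z))
        - L / 2 * lpNorm p (z' - z) ^ 2 := by
    rw [lpNorm_smul hp, mul_pow, sq_abs, dotProduct_smul, smul_eq_mul]
    field_simp
  have e2 : L / σ * (conj φ y' + z' ⬝ᵥ (y - y') + σ / 2 * lpNorm p (z' - z) ^ 2)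
      = L / σ * conj φ y' + t * (g ⬝ᵥ z') + L / 2 * lpNorm p (z' - z) ^ 2 := by
    rw [← hyv z', dotProduct_comm z', sub_dotProduct]
    field_simp
  have hyc := hyv c
  rw [e1] at F2
  rw [e2] at F3
  simp only [dotProduct_sub, sub_dotProduct] at F1 F2 F3 hK ⊢
  linarith

/-- Accelerated mirror descent reduces the objective gap. -/
theorem amd_rate (hp : 1 ≤ p) (hc : ConvexOn ℝ Set.univ f) (hf : IsLSmooth p L f)
    (hσ : 0 < σ) (hφ : ∀ u, HasGrowth p σ φ u (grad (conj φ) u)) {N : ℕ} {θ : ℤ → ℝ}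
    (hθ : IsThetaSeq N θ) (y₀ c : Vec n) :
    θ N ^ 2 * (f (amd f φ L σ θ y₀ N).x - f c)
      ≤ L / σ * (φ c + conj φ y₀ - y₀ ⬝ᵥ c) := by
  -- The last term holds the gradient at $x_k$, which the dual variable absorbs only at $y_{k+1}$.
  have key : ∀ k : ℕ, k ≤ N → θ k ^ 2 * (f (amd f φ L σ θ y₀ k).x - f c)
      ≤ L / σ * (conj φ y₀ - y₀ ⬝ᵥ c
          - (conj φ (amd f φ L σ θ y₀ k).y - (amd f φ L σ θ y₀ k).y ⬝ᵥ c))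
        + (θ k ^ 2 - θ ((k : ℤ) - 1) ^ 2) * (grad f (amd f φ L σ θ y₀ k).x
          ⬝ᵥ (grad (conj φ) (amd f φ L σ θ y₀ k).y - c)) := by
    intro k
    induction k with
    | zero =>
      intro _
      have h1 := add_grad_dotProduct_le hc hf.differentiable c (grad (conj φ) y₀)
      have h2 := hθ.neg (((0 : ℕ) : ℤ) - 1) (by norm_num)
      rw [h2]
      simp only [amd, sub_self, mul_zero, zero_add]
      have h3 := mul_le_mul_of_nonneg_left h1 (sq_nonneg (θ ((0 : ℕ) : ℤ)))
      simp only [dotProduct_sub] at h3 ⊢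
      linarith
    | succ k ih =>
      intro hk
      have hb := hθ.sq_sub_sq (i := k) (by omega) (by omega)
      have ht := hθ.pos k (by omega) (by omega)
      have ht' := hθ.pos ((k : ℤ) + 1) (by omega) (by omega)
      have htt := hθ.sq_sub_sq_nonneg (i := (k : ℤ) + 1) (by omega) (by omega)
      have hK := ih (by omega)
      rw [add_sub_cancel_right] at htt
      rw [hb] at hK
      have := amd_energy_step hp hc hf hσ hφ ht ht' htt
        (x := (amd f φ L σ θ y₀ k).x) (y := (amd f φ L σ θ y₀ k).y)
        (x' := (amd f φ L σ θ y₀ (k + 1)).x) (y' := (amd f φ L σ θ y₀ (k + 1)).y)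
        (by simp only [amd, hb]) (by simp only [amd, hb]) hK
      push_cast
      rw [add_sub_cancel_right]
      exact this
  have h := key N le_rfl
  -- The pending gradient term vanishes because $\theta_N=\theta_{N-1}$; Fenchel–Young at $y_N$ and
  -- $c$ does the rest.
  rw [hθ.last, sub_self, zero_mul, add_zero] at h
  rw [hθ.last]
  refine h.trans (mul_le_mul_of_nonneg_left ?_ (div_pos hf.pos hσ).le)
  have h1 := (hφ (amd f φ L σ θ y₀ N).y).conj_eq hσ.le
  have h2 := (hφ (amd f φ L σ θ y₀ N).y).fenchel_le hσ.le c
  linarith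

end AMD

/-! ### Energy argument for dual accelerated mirror descent -/

section DualAMD

variable {n : ℕ} {p L τ : ℝ} {f ψ : Vec n → ℝ}

/-- One-step estimate for dual accelerated mirror descent. -/
theorem dualAMD_energy_step (hp : 1 ≤ p) (hc : ConvexOn ℝ Set.univ f) (hf : IsLSmooth p L f)
    (hτ : 0 < τ) (hψ : ∀ u, HasGrowth p τ ψ u (grad (conj ψ) u)) {t b : ℝ} (ht : 0 < t)
    {q q' g g' r r' c : Vec n}
    (hq : q' = q - (τ / L * t) • grad (conj ψ) r)
    (hg : g' = g + (1 / t ^ 2) • (grad f q' - grad f q))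
    (hr : r' = r + t • (g' - g) + b • g')
    {K F : ℝ} (hK : conj ψ r ≤ L / τ * (K - 1 / t ^ 2 * (f q - F)
      - (g - (1 / t ^ 2) • grad f q) ⬝ᵥ (q - c)) + t * (g ⬝ᵥ grad (conj ψ) r)) :
    conj ψ r' ≤ L / τ * (K - 1 / t ^ 2 * (f q' - F)
      - (g - (1 / t ^ 2) • grad f q) ⬝ᵥ (q' - c)) + b * (g' ⬝ᵥ grad (conj ψ) r') := by
  have hL := hf.pos
  set w := grad (conj ψ) r
  set w' := grad (conj ψ) r'
  set G := grad f q
  set G' := grad f q'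
  have hqv : ∀ v, L / τ * (v ⬝ᵥ q - v ⬝ᵥ q') = t * (v ⬝ᵥ w) := by
    intro v
    rw [hq, dotProduct_sub, dotProduct_smul, smul_eq_mul]
    field_simp
    ring
  have hgv : ∀ v, g' ⬝ᵥ v = g ⬝ᵥ v + 1 / t ^ 2 * (G' ⬝ᵥ v - G ⬝ᵥ v) := by
    intro v
    rw [hg, add_dotProduct, smul_dotProduct, sub_dotProduct, smul_eq_mul]
  -- With this direction the loss is $\frac\tau2\|w'-w\|_p^2$, which cancels the gain in `F3`.
  have F2 := mul_le_mul_of_nonneg_left (hf.cocoercive hp hc q q' ((τ / L * t) • (w' - w)))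
    (show 0 ≤ L / τ * (1 / t ^ 2) by positivity)
  have F3 := (hψ r).bregman_conj_ge hτ.le (hψ r')
  have e1 : L / τ * (1 / t ^ 2) * (f q' + G' ⬝ᵥ (q - q') + (G' - G) ⬝ᵥ ((τ / L * t) • (w' - w))
        - L / 2 * lpNorm p ((τ / L * t) • (w' - w)) ^ 2)
      = L / τ * (1 / t ^ 2) * f q' + 1 / t ^ 2 * (t * (G' ⬝ᵥ w))
        + t * (1 / t ^ 2 * ((G' - G) ⬝ᵥ (w' - w))) - τ / 2 * lpNorm p (w' - w) ^ 2 := by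
    rw [lpNorm_smul hp, mul_pow, sq_abs, dotProduct_smul, smul_eq_mul, ← hqv G', dotProduct_sub G']
    field_simp
  have e2 : w' ⬝ᵥ (r - r') = -(t * (g' ⬝ᵥ w' - g ⬝ᵥ w')) - b * (g' ⬝ᵥ w') := by
    rw [hr, dotProduct_comm]
    simp only [sub_dotProduct, add_dotProduct, smul_dotProduct, smul_eq_mul]
    ring
  rw [e1] at F2
  rw [e2] at F3
  have k1 := hqv g
  have k2 := congrArg (1 / t ^ 2 * ·) (hqv G)
  have k3 := hgv w'
  simp only [dotProduct_sub, sub_dotProduct, smul_dotProduct, smul_eq_mul] at F2 hK k2 ⊢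
  rw [k3] at F3 ⊢
  linarith

/-- Dual accelerated mirror descent controls the conjugate function at the last auxiliary point. -/
theorem dualAMD_conj_le (hp : 1 ≤ p) (hc : ConvexOn ℝ Set.univ f) (hf : IsLSmooth p L f)
    (hτ : 0 < τ) (hψ : ∀ u, HasGrowth p τ ψ u (grad (conj ψ) u)) (hψ0 : ∀ x, 0 ≤ ψ x)
    {N : ℕ} {θ : ℤ → ℝ} (hN : 1 ≤ N) (hθ : IsThetaSeq N θ) (q₀ : Vec n) :
    conj ψ (dualAMD f ψ L τ θ N q₀ N).r
      ≤ L / τ * (1 / θ N ^ 2 * (f q₀ - f (dualAMD f ψ L τ θ N q₀ N).q)) := by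
  set S := dualAMD f ψ L τ θ N q₀ with hS
  -- The comparison point is the output itself, so its terms disappear at the end.
  set c := (S N).q
  have step : ∀ k : ℕ, k < N →
      conj ψ (S k).r ≤ L / τ * (1 / θ N ^ 2 * (f q₀ - f c)
          - 1 / θ ((N : ℤ) - k - 1) ^ 2 * (f (S k).q - f c)
          - ((S k).g - (1 / θ ((N : ℤ) - k - 1) ^ 2) • grad f (S k).q) ⬝ᵥ ((S k).q - c))
        + θ ((N : ℤ) - k - 1) * ((S k).g ⬝ᵥ grad (conj ψ) (S k).r) →
      conj ψ (S (k + 1)).r ≤ L / τ * (1 / θ N ^ 2 * (f q₀ - f c)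
          - 1 / θ ((N : ℤ) - k - 1) ^ 2 * (f (S (k + 1)).q - f c)
          - ((S k).g - (1 / θ ((N : ℤ) - k - 1) ^ 2) • grad f (S k).q) ⬝ᵥ ((S (k + 1)).q - c))
        + (θ ((N : ℤ) - k - 2) ^ 2 - θ ((N : ℤ) - k - 3) ^ 2)
          * ((S (k + 1)).g ⬝ᵥ grad (conj ψ) (S (k + 1)).r) := by
    intro k hk h
    have hb := hθ.sq_sub_sq (i := (N : ℤ) - k - 1) (by omega) (by omega)
    rw [show (N : ℤ) - k - 1 - 1 = (N : ℤ) - k - 2 by ring] at hb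
    exact dualAMD_energy_step hp hc hf hτ hψ (hθ.pos _ (by omega) (by omega))
      (by simp only [hS, dualAMD, hb]) (by simp only [hS, dualAMD])
      (by simp only [hS, dualAMD, hb]) h
  have key : ∀ k : ℕ, k < N →
      conj ψ (S k).r ≤ L / τ * (1 / θ N ^ 2 * (f q₀ - f c)
          - 1 / θ ((N : ℤ) - k - 1) ^ 2 * (f (S k).q - f c)
          - ((S k).g - (1 / θ ((N : ℤ) - k - 1) ^ 2) • grad f (S k).q) ⬝ᵥ ((S k).q - c))
        + θ ((N : ℤ) - k - 1) * ((S k).g ⬝ᵥ grad (conj ψ) (S k).r) := by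
    intro k
    induction k with
    | zero =>
      intro hk
      have hb := hθ.sq_sub_sq (i := (N : ℤ) - 1) (by omega) (by omega)
      have h1 := (hψ (S 0).r).conj_eq hτ.le
      have h2 := hψ0 (grad (conj ψ) (S 0).r)
      -- Since $\theta_N=\theta_{N-1}$, $r_0$ is $\theta_{N-1}g_0$; then $\psi\ge0$ bounds
      -- $\psi^*(r_0)$ by the pairing alone.
      have h3 : (S 0).r = θ ((N : ℤ) - 1) • (S 0).g := by
        simp only [hS, dualAMD]
        rw [hθ.last, smul_smul, show (N : ℤ) - 2 = (N : ℤ) - 1 - 1 by ring, hb]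
        congr 1
        ring
      have h4 : (S 0).r ⬝ᵥ grad (conj ψ) (S 0).r
          = θ ((N : ℤ) - 1) * ((S 0).g ⬝ᵥ grad (conj ψ) (S 0).r) := by
        conv_lhs => rw [h3]
        rw [smul_dotProduct, smul_eq_mul, ← h3]
      have h5 : (S 0).g = (1 / θ ((N : ℤ) - 1) ^ 2) • grad f (S 0).q := by
        simp only [hS, dualAMD, hθ.last]
      have h6 : f (S 0).q = f q₀ := by simp only [hS, dualAMD]
      rw [Nat.cast_zero, sub_zero, ← h5, sub_self, zero_dotProduct, hθ.last, h6, h1, h4]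
      linarith
    | succ k ih =>
      intro hk
      have h := step k (by omega) (ih (by omega))
      have hb := hθ.sq_sub_sq (i := (N : ℤ) - k - 2) (by omega) (by omega)
      rw [show (N : ℤ) - k - 2 - 1 = (N : ℤ) - k - 3 by ring] at hb
      rw [hb] at h
      have e : (N : ℤ) - ((k + 1 : ℕ) : ℤ) - 1 = (N : ℤ) - k - 2 := by push_cast; ring
      rw [e]
      have hm := hθ.sq_sub_sq_nonneg (i := (N : ℤ) - k - 1) (by omega) (by omega)
      rw [show (N : ℤ) - k - 1 - 1 = (N : ℤ) - k - 2 by ring] at hm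
      have hpos := hθ.pos ((N : ℤ) - k - 2) (by omega) (by omega)
      -- The update of $g$ preserves $g-\theta_{N-k-1}^{-2}\nabla f(q)$. Passing to the larger
      -- weight $\theta_{N-k-2}^{-2}$ then costs nothing, by convexity between $q_{k+1}$ and $c$.
      have hβ : 1 / θ ((N : ℤ) - k - 1) ^ 2 ≤ 1 / θ ((N : ℤ) - k - 2) ^ 2 :=
        one_div_le_one_div_of_le (by positivity) (by linarith)
      have hF := mul_le_mul_of_nonneg_left
        (mul_le_mul_of_nonneg_left
          (add_grad_dotProduct_le hc hf.differentiable c (S (k + 1)).q) (sub_nonneg.2 hβ))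
        (div_pos hf.pos hτ).le
      have hg : (S (k + 1)).g = (S k).g + (1 / θ ((N : ℤ) - k - 1) ^ 2)
          • (grad f (S (k + 1)).q - grad f (S k).q) := by simp only [hS, dualAMD]
      have hgv : ∀ v, (S (k + 1)).g ⬝ᵥ v = (S k).g ⬝ᵥ v + 1 / θ ((N : ℤ) - k - 1) ^ 2
          * (grad f (S (k + 1)).q ⬝ᵥ v - grad f (S k).q ⬝ᵥ v) := by
        intro v
        rw [hg, add_dotProduct, smul_dotProduct, sub_dotProduct, smul_eq_mul]
      have k1 := congrArg (L / τ * ·) (hgv (S (k + 1)).q)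
      have k2 := congrArg (L / τ * ·) (hgv c)
      simp only [dotProduct_sub, sub_dotProduct, smul_dotProduct, smul_eq_mul] at h hF k1 k2 ⊢
      linarith
  -- The last step has no change of weight, as $\theta_{-1}=0$; its coefficient
  -- $\theta_{-1}^2-\theta_{-2}^2$ is zero.
  obtain ⟨m, hm⟩ : ∃ m, N = m + 1 := ⟨N - 1, by omega⟩
  have h := step m (by omega) (key m (by omega))
  rw [hθ.neg ((N : ℤ) - m - 2) (by omega), hθ.neg ((N : ℤ) - m - 3) (by omega), ← hm,
    sub_self (f c), sub_self c, dotProduct_zero] at h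
  simpa using h

/-- The last auxiliary point of dual accelerated mirror descent is the gradient at the output. -/
theorem dualAMD_r_last {N : ℕ} {θ : ℤ → ℝ} (hθ : IsThetaSeq N θ) (q₀ : Vec n) :
    (dualAMD f ψ L τ θ N q₀ N).r = grad f (dualAMD f ψ L τ θ N q₀ N).q := by
  set S := dualAMD f ψ L τ θ N q₀ with hS
  -- The updates of $g$ and $r$ telescope to this invariant, whose correction vanishes at $k=N$
  -- because $\theta_{-2}=0$.
  have key : ∀ k : ℕ, k ≤ N →
      grad f (S k).q = (S k).r + θ ((N : ℤ) - k - 2) ^ 2 • (S k).g := by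
    intro k
    induction k with
    | zero =>
      intro _
      have := (hθ.pos N (by omega) le_rfl).ne'
      simp only [hS, dualAMD, Nat.cast_zero, sub_zero]
      rw [smul_smul, ← add_smul]
      conv_lhs => rw [← one_smul ℝ (grad f q₀)]
      congr 1
      field_simp
      ring
    | succ k ih =>
      intro hk
      have h := ih (by omega)
      have hne := (hθ.pos ((N : ℤ) - k - 1) (by omega) (by omega)).ne'
      have hg : (S (k + 1)).g = (S k).g + (1 / θ ((N : ℤ) - k - 1) ^ 2)
          • (grad f (S (k + 1)).q - grad f (S k).q) := by simp only [hS, dualAMD]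
      have hr : (S (k + 1)).r = (S k).r
          + (θ ((N : ℤ) - k - 1) ^ 2 - θ ((N : ℤ) - k - 2) ^ 2) • ((S (k + 1)).g - (S k).g)
          + (θ ((N : ℤ) - k - 2) ^ 2 - θ ((N : ℤ) - k - 3) ^ 2) • (S (k + 1)).g := by
        simp only [hS, dualAMD]
      have hG : grad f (S (k + 1)).q
          = grad f (S k).q + θ ((N : ℤ) - k - 1) ^ 2 • ((S (k + 1)).g - (S k).g) := by
        rw [hg, add_sub_cancel_left, smul_smul, mul_one_div_cancel (pow_ne_zero 2 hne), one_smul,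
          add_sub_cancel]
      have e : (N : ℤ) - ((k + 1 : ℕ) : ℤ) - 2 = (N : ℤ) - k - 3 := by push_cast; ring
      rw [e, hG, h, hr]
      module
  have h := key N le_rfl
  rw [hθ.neg ((N : ℤ) - N - 2) (by omega)] at h
  simpa using h.symm

end DualAMD

end MirrorDuality

/-! ### Concatenation of the two methods -/

theorem mainTheorem4 :
    ∃ C : ℝ, 0 < C ∧
      ∀ (p q : ℝ), 1 < p → p ≤ 2 → q = p / (p - 1) →
      ∀ (n : ℕ) (f : MirrorDuality.Vec n → ℝ) (L : ℝ),
        ConvexOn ℝ Set.univ f →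
        MirrorDuality.IsLSmooth p L f →
      ∀ (x₀ xstar : MirrorDuality.Vec n), (∀ x, f xstar ≤ f x) →
      ∀ (φ ψ : MirrorDuality.Vec n → ℝ),
        φ = MirrorDuality.halfSqNorm p x₀ →
        ψ = MirrorDuality.halfSqNorm p 0 →
      ∀ (N : ℕ) (θ : ℤ → ℝ), 1 ≤ N → MirrorDuality.IsThetaSeq N θ →
      ∀ (σ τ : ℝ), σ = p - 1 → τ = p - 1 →
      ∀ (y₀ x2N : MirrorDuality.Vec n),
        y₀ = MirrorDuality.grad φ x₀ →
        x2N = MirrorDuality.concatOutput f φ ψ L σ τ θ N y₀ →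
        -- the methods are well defined and start at the given point
        (MirrorDuality.ConjFinite φ ∧ Differentiable ℝ (MirrorDuality.conj φ)) ∧
        (MirrorDuality.ConjFinite ψ ∧ Differentiable ℝ (MirrorDuality.conj ψ)) ∧
        (y₀ = 0 ∧ MirrorDuality.grad (MirrorDuality.conj φ) y₀ = x₀) ∧
        -- the rate
        MirrorDuality.lpNorm q (MirrorDuality.grad f x2N)
          ≤ L * MirrorDuality.lpNorm p (x₀ - xstar) / ((p - 1) * θ N ^ 2) ∧
        L * MirrorDuality.lpNorm p (x₀ - xstar) / ((p - 1) * θ N ^ 2)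
          ≤ C / (p - 1) * (L * MirrorDuality.lpNorm p (x₀ - xstar) / (N : ℝ) ^ 2) := by
  -- The constant is 4 because $\theta_N\ge N/2$.
  refine ⟨4, by norm_num, ?_⟩
  intro p q hp hp2 hq n f L hc hf x₀ xstar hmin φ ψ hφ hψ N θ hN hθ σ τ hσ hτ y₀ x2N hy hx
  have hpq : p.HolderConjugate q := (Real.holderConjugate_iff_eq_conjExponent hp).2 hq
  have hp1 : 0 < p - 1 := by linarith
  have hL := hf.pos
  subst hσ hτ hφ hψ
  have Eφ := MirrorDuality.exists_hasGrowth_halfSqNorm hp hp2 x₀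
  have Eψ := MirrorDuality.exists_hasGrowth_halfSqNorm hp hp2 (0 : MirrorDuality.Vec n)
  have Gφ := MirrorDuality.hasGrowth_grad_conj hp1 hp.le Eφ
  have Gψ := MirrorDuality.hasGrowth_grad_conj hp1 hp.le Eψ
  have hy0 : y₀ = 0 := hy.trans (MirrorDuality.grad_halfSqNorm_self hp.le x₀)
  have hx0 : MirrorDuality.grad (MirrorDuality.conj (MirrorDuality.halfSqNorm p x₀)) y₀ = x₀ := by
    rw [hy0]
    exact (Gφ 0).eq_center hp
  have hθN := hθ.pos N (by omega) le_rfl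
  refine ⟨⟨fun u => (Gφ u).bddAbove hp1.le, fun u =>
      ((Gφ u).hasFDerivAt_conj hp1 hp.le Eφ).differentiableAt⟩,
    ⟨fun u => (Gψ u).bddAbove hp1.le, fun u =>
      ((Gψ u).hasFDerivAt_conj hp1 hp.le Eψ).differentiableAt⟩, ⟨hy0, hx0⟩, ?_, ?_⟩
  · have h1 := MirrorDuality.amd_rate hp.le hc hf hp1 Gφ hθ y₀ xstar
    have h2 := MirrorDuality.dualAMD_conj_le hp.le hc hf hp1 Gψ
      (MirrorDuality.halfSqNorm_nonneg 0) hN hθ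
      (MirrorDuality.amd f (MirrorDuality.halfSqNorm p x₀) L (p - 1) θ y₀ N).x
    rw [MirrorDuality.dualAMD_r_last hθ] at h2
    change MirrorDuality.conj _ (MirrorDuality.grad f (MirrorDuality.concatOutput f
      (MirrorDuality.halfSqNorm p x₀) (MirrorDuality.halfSqNorm p 0) L (p - 1) (p - 1) θ N y₀))
      ≤ L / (p - 1) * (1 / θ N ^ 2 * (_ - f (MirrorDuality.concatOutput f
      (MirrorDuality.halfSqNorm p x₀) (MirrorDuality.halfSqNorm p 0) L (p - 1) (p - 1) θ N y₀)))
      at h2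
    rw [← hx] at h2
    have h3 := MirrorDuality.half_sq_lpNorm_le_conj hpq
      ((Gψ (MirrorDuality.grad f x2N)).bddAbove hp1.le)
    have h4 := (Gφ y₀).conj_eq hp1.le
    rw [hx0, MirrorDuality.halfSqNorm_self hp.le, sub_zero] at h4
    rw [h4, hy0, zero_dotProduct, zero_dotProduct, add_zero, sub_zero,
      MirrorDuality.halfSqNorm, MirrorDuality.lpNorm_sub_comm hp.le, ← hy0] at h1
    set D := MirrorDuality.lpNorm p (x₀ - xstar)
    set X := (MirrorDuality.amd f (MirrorDuality.halfSqNorm p x₀) L (p - 1) θ y₀ N).x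
    have hD : 0 ≤ D := MirrorDuality.lpNorm_nonneg hp.le _
    -- Minimality of $x_\star$ replaces $f(x_\star)$ by $f(x_{2N})$ in the AMD bound.
    have h5 : f X - f x2N ≤ L / (p - 1) * (1 / 2 * D ^ 2) / θ N ^ 2 := by
      rw [le_div_iff₀ (by positivity)]
      nlinarith [hmin x2N, sq_nonneg (θ N)]
    have h6 := h3.trans (h2.trans (mul_le_mul_of_nonneg_left
      (mul_le_mul_of_nonneg_left h5 (by positivity)) (div_pos hL hp1).le))
    refine abs_le_of_sq_le_sq' ?_ (by positivity) |>.2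
    calc MirrorDuality.lpNorm q (MirrorDuality.grad f x2N) ^ 2
        ≤ 2 * (L / (p - 1) * (1 / θ N ^ 2 * (L / (p - 1) * (1 / 2 * D ^ 2) / θ N ^ 2))) := by
          linarith
      _ = (L * D / ((p - 1) * θ N ^ 2)) ^ 2 := by
          field_simp
  · have h1 := hθ.half_le_last hN
    have hN0 : (0 : ℝ) < N := by exact_mod_cast hN
    have hD : 0 ≤ L * MirrorDuality.lpNorm p (x₀ - xstar) :=
      mul_nonneg hL.le (MirrorDuality.lpNorm_nonneg hp.le _)
    rw [div_mul_div_comm, div_le_div_iff₀ (by positivity) (by positivity)]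
    have h2 : (N : ℝ) ^ 2 ≤ 4 * θ N ^ 2 := by nlinarith
    have h3 := mul_le_mul_of_nonneg_left h2 (mul_nonneg hD hp1.le)
    linarith
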